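/- Let $G$ be a finite graph (undirected, without loops or multiple edges) whose vertices and edges are colored; write $c(x)$ for the color of a vertex or edge $x$, and suppose that $\deg(v)\ge 3$ for every vertex $v$ of $G$. For every vertex color $s$ let $n_s\in\mathbb N_0$ be such that $n_s\ne n_{s'}$ for distinct vertex colors $s\ne s'$, and fix an edge color $c_0$. Let $G'$ be the edge-colored graph obtained from $G$ by attaching to each vertex $v$ a path of length $n_{c(v)}$ (i.e. a path $v=v_0,v_1,\dots,v_{n_{c(v)}}$ with new vertices $v_1,\dots,v_{n_{c(v)}}$), giving all edges of the attached paths the color $c_0$, keeping the colors of the edges of $G$, and forgetting the vertex colors. For a finite vertex- and edge-colored graph $H$, let $C(\mathrm{Qut}(H))$ be the universal unital $C^*$-algebra with generators $u_{ij}$, $i,j\in V(H)$, and relations $u_{ij}=u_{ij}^*=u_{ij}^2$, $\sum_l u_{il}=1=\sum_l u_{li}$, $u_{ij}=0$ whenever $c(i)\ne c(j)$, and $A_{H_c}u=uA_{H_c}$ for all edge colors $c$, where $A_{H_c}$ is the adjacency matrix of the edges of color $c$ (if the vertices of $H$ are not colored, all of them are regarded as having the same color). Let $\Delta_H:C(\mathrm{Qut}(H))\to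 C(\mathrm{Qut}(H))\otimes C(\mathrm{Qut}(H))$ be the unital $*$-homomorphism with $\Delta_H(u_{ij})=\sum_k u_{ik}\otimes u_{kj}$, where $\otimes$ is the minimal tensor product of $C^*$-algebras. Then there exists a $*$-isomorphism $\varphi:C(\mathrm{Qut}(G))\to C(\mathrm{Qut}(G'))$ such that $\Delta_{G'}\circ\varphi=(\varphi\otimes\varphi)\circ\Delta_G$; that is, $\mathrm{Qut}(G)\cong\mathrm{Qut}(G')$ as compact quantum groups. -/

import Mathlib

open scoped TensorProduct

universe u v w

noncomputable section

/-! ### C*-seminorms, and the C*-algebra obtained by Hausdorff completion -/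

/-- A C*-seminorm on a unital complex *-algebra. -/
structure CStarSeminorm (A : Type u) [Ring A] [StarRing A] [Algebra ℂ A] extends
    Seminorm ℂ A where
  mul_le' : ∀ a b : A, toFun (a * b) ≤ toFun a * toFun b
  star_mul_self' : ∀ a : A, toFun (star a * a) = toFun a * toFun a

namespace CStarSeminorm

variable {A : Type u} [Ring A] [StarRing A] [Algebra ℂ A]

instance : CoeFun (CStarSeminorm A) (fun _ => A → ℝ) := ⟨fun p => p.toSeminorm⟩

theorem mul_le (p : CStarSeminorm A) (a b : A) : p (a * b) ≤ p a * p b := p.mul_le' a b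

theorem star_mul_self (p : CStarSeminorm A) (a : A) : p (star a * a) = p a * p a :=
  p.star_mul_self' a

theorem nonneg (p : CStarSeminorm A) (a : A) : 0 ≤ p a := apply_nonneg p.toSeminorm a

theorem le_star (p : CStarSeminorm A) (a : A) : p a ≤ p (star a) := by
  have h1 := p.star_mul_self a
  have h2 := p.mul_le (star a) a
  rcases (p.nonneg a).eq_or_lt with h | h
  · rw [← h]; exact p.nonneg _
  · nlinarith

theorem star_eq (p : CStarSeminorm A) (a : A) : p (star a) = p a :=
  le_antisymm (by simpa using p.le_star (star a)) (p.le_star a)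

/-- The pointwise supremum of a pointwise bounded family of C*-seminorms. -/
def iSup {ι : Sort w} (f : ι → CStarSeminorm A)
    (hf : ∀ a, BddAbove (Set.range fun i => f i a)) : CStarSeminorm A where
  toFun a := ⨆ i, f i a
  map_zero' := by simp
  add_le' a b := by
    rcases isEmpty_or_nonempty ι with h | h
    · simp [Real.iSup_of_isEmpty]
    · refine ciSup_le fun i => (map_add_le_add (f i).toSeminorm a b).trans ?_
      exact add_le_add (le_ciSup (hf a) i) (le_ciSup (hf b) i)
  neg' a := by simp
  smul' r a := by
    simp only [map_smul_eq_mul]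
    exact (Real.mul_iSup_of_nonneg (norm_nonneg r) _).symm
  mul_le' a b := by
    rcases isEmpty_or_nonempty ι with h | h
    · simp [Real.iSup_of_isEmpty]
    · refine ciSup_le fun i => ((f i).mul_le a b).trans ?_
      exact mul_le_mul (le_ciSup (hf a) i) (le_ciSup (hf b) i) ((f i).nonneg b)
        (((f i).nonneg a).trans (le_ciSup (hf a) i))
  star_mul_self' a := by
    rcases isEmpty_or_nonempty ι with h | h
    · simp [Real.iSup_of_isEmpty]
    · have h0 : 0 ≤ ⨆ i, f i a := Real.iSup_nonneg fun i => (f i).nonneg a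
      apply le_antisymm
      · refine ciSup_le fun i => ((f i).star_mul_self a).le.trans ?_
        exact mul_le_mul (le_ciSup (hf a) i) (le_ciSup (hf a) i) ((f i).nonneg a) h0
      · have key : (⨆ i, f i a) ≤ Real.sqrt (⨆ i, f i (star a * a)) := by
          refine ciSup_le fun i => Real.le_sqrt_of_sq_le ?_
          rw [pow_two, ← (f i).star_mul_self a]
          exact le_ciSup (hf (star a * a)) i
        have h1 : 0 ≤ ⨆ i, f i (star a * a) := Real.iSup_nonneg fun i => (f i).nonneg _
        calc (⨆ i, f i a) * (⨆ i, f i a)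
            ≤ Real.sqrt (⨆ i, f i (star a * a)) * Real.sqrt (⨆ i, f i (star a * a)) :=
              mul_le_mul key key h0 (Real.sqrt_nonneg _)
          _ = _ := Real.mul_self_sqrt h1

theorem iSup_apply {ι : Sort w} (f : ι → CStarSeminorm A)
    (hf : ∀ a, BddAbove (Set.range fun i => f i a)) (a : A) :
    iSup f hf a = ⨆ i, f i a := rfl

/-- The *-algebra `A`, regarded as a seminormed algebra by means of `p`. -/
def Pre (_ : CStarSeminorm A) : Type u := A

namespace Pre

variable (p : CStarSeminorm A)

instance : SeminormedRing p.Pre :=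
  { (inferInstance : Ring A),
    p.toAddGroupSeminorm.toSeminormedAddCommGroup with
    norm_mul_le := p.mul_le }

instance : StarRing p.Pre := (inferInstance : StarRing A)

instance : NormedAlgebra ℂ p.Pre :=
  { (inferInstance : Algebra ℂ A) with
    norm_smul_le := fun r a => (map_smul_eq_mul p.toSeminorm r a).le }

instance [StarModule ℂ A] : StarModule ℂ p.Pre := (inferInstance : StarModule ℂ A)

theorem norm_star (a : p.Pre) : ‖star a‖ = ‖a‖ := p.star_eq a

theorem norm_star_mul_self (a : p.Pre) : ‖star a * a‖ = ‖a‖ * ‖a‖ := p.star_mul_self a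

instance : NormedStarGroup p.Pre := ⟨fun a => (norm_star p a).le⟩

end Pre

/-- The Hausdorff completion of a *-algebra with respect to a C*-seminorm. -/
def Completed (p : CStarSeminorm A) : Type u := UniformSpace.Completion p.Pre

namespace Completed

open UniformSpace (Completion)

variable (p : CStarSeminorm A)

instance : NormedRing p.Completed := inferInstanceAs (NormedRing (Completion p.Pre))

instance : CompleteSpace p.Completed := inferInstanceAs (CompleteSpace (Completion p.Pre))

instance : NormedAlgebra ℂ p.Completed :=
  { (inferInstance : Algebra ℂ (Completion p.Pre)) with
    norm_smul_le := (inferInstance : NormedSpace ℂ (Completion p.Pre)).norm_smul_le }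

theorem uniformContinuous_star_pre : UniformContinuous (star : p.Pre → p.Pre) :=
  (starNormedAddGroupHom : NormedAddGroupHom p.Pre p.Pre).uniformContinuous

instance : Star p.Completed := ⟨Completion.map (star : p.Pre → p.Pre)⟩

theorem continuous_star : Continuous (star : p.Completed → p.Completed) :=
  Completion.continuous_map

/-- The canonical map from the *-algebra to its completion. -/
def coe (a : A) : p.Completed := ((show p.Pre from a : p.Pre) : Completion p.Pre)

theorem norm_coe (a : A) : ‖coe p a‖ = p a := Completion.norm_coe (E := p.Pre) a

theorem star_coe (a : A) : star (coe p a) = coe p (star a) :=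
  Completion.map_coe (uniformContinuous_star_pre p) a

theorem coe_mul (a b : A) : coe p (a * b) = coe p a * coe p b :=
  Completion.coe_mul (α := p.Pre) a b

theorem coe_add (a b : A) : coe p (a + b) = coe p a + coe p b :=
  Completion.coe_add (α := p.Pre) a b

theorem coe_one : coe p 1 = 1 := Completion.coe_one p.Pre

theorem coe_zero : coe p 0 = 0 := Completion.coe_zero (α := p.Pre)

theorem coe_smul (r : ℂ) (a : A) : coe p (r • a) = r • coe p a :=
  Completion.coe_smul (X := p.Pre) r a

theorem continuous_coe : Continuous (fun a : p.Pre => coe p a) :=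
  Completion.continuous_coe p.Pre

@[elab_as_elim]
theorem induction_on {P : p.Completed → Prop} (a : p.Completed) (hp : IsClosed {a | P a})
    (ih : ∀ a : A, P (coe p a)) : P a :=
  Completion.induction_on (α := p.Pre) a hp ih

@[elab_as_elim]
theorem induction_on₂ {P : p.Completed → p.Completed → Prop} (a b : p.Completed)
    (hp : IsClosed {x : p.Completed × p.Completed | P x.1 x.2})
    (ih : ∀ a b : A, P (coe p a) (coe p b)) : P a b :=
  Completion.induction_on₂ (α := p.Pre) (β := p.Pre) a b hp ih

instance : StarRing p.Completed where
  star_involutive a := by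
    have hc := continuous_star p
    refine induction_on p a (isClosed_eq (by fun_prop) (by fun_prop)) fun a => ?_
    simp [star_coe]
  star_mul a b := by
    have hc := continuous_star p
    refine induction_on₂ p a b (isClosed_eq (by fun_prop) (by fun_prop)) fun a b => ?_
    simp [star_coe, ← coe_mul]
  star_add a b := by
    have hc := continuous_star p
    refine induction_on₂ p a b (isClosed_eq (by fun_prop) (by fun_prop)) fun a b => ?_
    simp [star_coe, ← coe_add]

instance : CStarRing p.Completed where
  norm_mul_self_le a := by
    have hc := continuous_star p
    refine induction_on p a (isClosed_le (by fun_prop) (by fun_prop)) fun a => ?_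
    rw [star_coe, ← coe_mul, norm_coe, norm_coe, p.star_mul_self]

variable [StarModule ℂ A]

instance : StarModule ℂ p.Completed where
  star_smul r a := by
    have hc := continuous_star p
    have h1 : Continuous fun a : p.Completed => star (r • a) :=
      hc.comp (continuous_const_smul r)
    have h2 : Continuous fun a : p.Completed => star r • star a := hc.const_smul (star r)
    refine induction_on p a (isClosed_eq h1 h2) fun a => ?_
    rw [← coe_smul, star_coe, star_coe, star_smul, coe_smul]

instance : CStarAlgebra p.Completed where

/-- The canonical *-homomorphism from the *-algebra to its completion. -/
def of : A →⋆ₐ[ℂ] p.Completed where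
  toFun := coe p
  map_one' := coe_one p
  map_mul' := coe_mul p
  map_zero' := coe_zero p
  map_add' := coe_add p
  commutes' r := by
    rw [Algebra.algebraMap_eq_smul_one, coe_smul, coe_one, Algebra.algebraMap_eq_smul_one]
  map_star' a := (star_coe p a).symm

set_option linter.unusedSectionVars false in
theorem norm_of (a : A) : ‖of p a‖ = p a := norm_coe p a

variable {B : Type v} [CStarAlgebra B]

set_option linter.unusedSectionVars false in
theorem uniformContinuous_pre (f : A →⋆ₐ[ℂ] B) (hf : ∀ a, ‖f a‖ ≤ p a) :
    UniformContinuous (fun a : p.Pre => f a) :=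
  AddMonoidHomClass.uniformContinuous_of_bound
    (show p.Pre →+ B from (f : A →+* B).toAddMonoidHom) 1 (fun a => by
      rw [one_mul]; exact hf a)

/-- The underlying function of the extension of a *-homomorphism to the completion. -/
def liftFun (f : A →⋆ₐ[ℂ] B) : p.Completed → B :=
  Completion.extension (fun a : p.Pre => f a)

set_option linter.unusedSectionVars false in
theorem continuous_liftFun (f : A →⋆ₐ[ℂ] B) : Continuous (liftFun p f) :=
  Completion.continuous_extension

theorem liftFun_coe (f : A →⋆ₐ[ℂ] B) (hf : ∀ a, ‖f a‖ ≤ p a) (a : A) :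
    liftFun p f (coe p a) = f a :=
  Completion.extension_coe (uniformContinuous_pre p f hf) a

/-- A *-homomorphism into a C*-algebra that is dominated by the C*-seminorm extends to the
completion. -/
def lift (f : A →⋆ₐ[ℂ] B) (hf : ∀ a, ‖f a‖ ≤ p a) : p.Completed →⋆ₐ[ℂ] B where
  toFun := liftFun p f
  map_one' := by rw [← coe_one, liftFun_coe p f hf, map_one]
  map_zero' := by rw [← coe_zero, liftFun_coe p f hf, map_zero]
  map_mul' a b := by
    have hc := continuous_liftFun p f
    refine induction_on₂ p a b (isClosed_eq (by fun_prop) (by fun_prop)) fun a b => ?_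
    simp only [← coe_mul, liftFun_coe p f hf, map_mul]
  map_add' a b := by
    have hc := continuous_liftFun p f
    refine induction_on₂ p a b (isClosed_eq (by fun_prop) (by fun_prop)) fun a b => ?_
    simp only [← coe_add, liftFun_coe p f hf, map_add]
  commutes' r := by
    rw [Algebra.algebraMap_eq_smul_one, ← coe_one, ← coe_smul, liftFun_coe p f hf, map_smul,
      map_one, Algebra.algebraMap_eq_smul_one]
  map_star' a := by
    have hc := continuous_liftFun p f
    have hs := continuous_star p
    refine induction_on p a (isClosed_eq (by fun_prop) (by fun_prop)) fun a => ?_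
    simp only [star_coe, liftFun_coe p f hf, map_star]

theorem lift_of (f : A →⋆ₐ[ℂ] B) (hf : ∀ a, ‖f a‖ ≤ p a) (a : A) :
    lift p f hf (of p a) = f a := liftFun_coe p f hf a

end Completed

end CStarSeminorm

/-! ### The free unital *-algebra -/

/-- The free unital complex *-algebra on a set `X`: noncommutative polynomials in the symbols
`x` (`Sum.inl x`) and `x*` (`Sum.inr x`), `x ∈ X`. -/
def FreeStarAlgebra (X : Type u) : Type u := FreeAlgebra ℂ (X ⊕ X)

namespace FreeStarAlgebra

variable {X : Type u}

instance : Ring (FreeStarAlgebra X) := inferInstanceAs (Ring (FreeAlgebra ℂ (X ⊕ X)))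

instance : Algebra ℂ (FreeStarAlgebra X) :=
  inferInstanceAs (Algebra ℂ (FreeAlgebra ℂ (X ⊕ X)))

/-- The symbols `x` and `x*`. -/
def sym (y : X ⊕ X) : FreeStarAlgebra X := FreeAlgebra.ι ℂ y

@[elab_as_elim]
theorem induction {C : FreeStarAlgebra X → Prop}
    (h_alg : ∀ r : ℂ, C (algebraMap ℂ (FreeStarAlgebra X) r)) (h_sym : ∀ y, C (sym y))
    (h_mul : ∀ a b, C a → C b → C (a * b)) (h_add : ∀ a b, C a → C b → C (a + b))
    (a : FreeStarAlgebra X) : C a :=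
  FreeAlgebra.induction (motive := C) _ _ h_alg h_sym h_mul h_add a

/-- The opposite ring of the free *-algebra with the conjugate scalar multiplication; it is only
used to define the conjugate-linear, antimultiplicative involution. -/
def ConjOp (X : Type u) : Type u := (FreeStarAlgebra X)ᵐᵒᵖ

instance : Ring (ConjOp X) := inferInstanceAs (Ring (FreeStarAlgebra X)ᵐᵒᵖ)

instance : Algebra ℂ (ConjOp X) :=
  ((algebraMap ℂ (FreeStarAlgebra X)ᵐᵒᵖ).comp (starRingEnd ℂ)).toAlgebra'
    (fun c x => Algebra.commutes (A := (FreeStarAlgebra X)ᵐᵒᵖ) (starRingEnd ℂ c) x)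

/-- The involution as an algebra homomorphism. -/
def starHom : FreeAlgebra ℂ (X ⊕ X) →ₐ[ℂ] ConjOp X :=
  FreeAlgebra.lift ℂ (fun y => (MulOpposite.op (sym y.swap) : (FreeStarAlgebra X)ᵐᵒᵖ))

instance : Star (FreeStarAlgebra X) :=
  ⟨fun a => MulOpposite.unop (show (FreeStarAlgebra X)ᵐᵒᵖ from starHom a)⟩

theorem star_sym (y : X ⊕ X) : star (sym y) = sym y.swap := by
  have : starHom (FreeAlgebra.ι ℂ y) =
      (MulOpposite.op (sym y.swap) : (FreeStarAlgebra X)ᵐᵒᵖ) := FreeAlgebra.lift_ι_apply _ _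
  exact congrArg MulOpposite.unop this

theorem star_mul_aux (a b : FreeStarAlgebra X) : star (a * b) = star b * star a :=
  congrArg MulOpposite.unop (map_mul (starHom (X := X)) a b)

theorem star_add_aux (a b : FreeStarAlgebra X) : star (a + b) = star a + star b :=
  congrArg MulOpposite.unop (map_add (starHom (X := X)) a b)

theorem star_algebraMap (r : ℂ) :
    star (algebraMap ℂ (FreeStarAlgebra X) r) = algebraMap ℂ _ (star r) :=
  congrArg MulOpposite.unop ((starHom (X := X)).commutes r)

instance : StarRing (FreeStarAlgebra X) where
  star_involutive a := by
    induction a using induction with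
    | h_alg r => simp [star_algebraMap]
    | h_sym y => simp [star_sym]
    | h_mul a b ha hb => rw [star_mul_aux, star_mul_aux, ha, hb]
    | h_add a b ha hb => rw [star_add_aux, star_add_aux, ha, hb]
  star_mul := star_mul_aux
  star_add := star_add_aux

instance : StarModule ℂ (FreeStarAlgebra X) where
  star_smul r a := by
    rw [Algebra.smul_def, star_mul, star_algebraMap, ← Algebra.commutes, ← Algebra.smul_def]

/-- The generator `x`. -/
def gen (x : X) : FreeStarAlgebra X := sym (Sum.inl x)

theorem star_gen (x : X) : star (gen x) = sym (Sum.inr x) := star_sym _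

variable {B : Type v} [Ring B] [StarRing B] [Algebra ℂ B] [StarModule ℂ B]

/-- The algebra homomorphism underlying `FreeStarAlgebra.lift`. -/
def liftAlg (f : X → B) : FreeStarAlgebra X →ₐ[ℂ] B :=
  FreeAlgebra.lift ℂ (Sum.elim f fun x => star (f x))

set_option linter.unusedSectionVars false in
theorem liftAlg_sym (f : X → B) (y : X ⊕ X) :
    liftAlg f (sym y) = Sum.elim f (fun x => star (f x)) y := FreeAlgebra.lift_ι_apply _ _

/-- The universal property of the free *-algebra. -/
def lift (f : X → B) : FreeStarAlgebra X →⋆ₐ[ℂ] B :=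
  { liftAlg f with
    map_star' := fun a => by
      change liftAlg f (star a) = star (liftAlg f a)
      induction a using induction with
      | h_alg r => rw [star_algebraMap, AlgHom.commutes, AlgHom.commutes, algebraMap_star_comm]
      | h_sym y => rcases y with y | y <;> simp [star_sym, liftAlg_sym]
      | h_mul a b ha hb => rw [star_mul, map_mul, map_mul, star_mul, ha, hb]
      | h_add a b ha hb => rw [star_add, map_add, map_add, star_add, ha, hb] }

theorem lift_gen (f : X → B) (x : X) : lift f (gen x) = f x := liftAlg_sym f (Sum.inl x)

end FreeStarAlgebra

/-! ### The universal C*-algebra given by generators and relations -/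

namespace CStarSeminorm

variable {X : Type u} (R : FreeStarAlgebra X → FreeStarAlgebra X → Prop)

/-- A C*-seminorm on the free *-algebra respects the relations `a = b`, for `R a b`. -/
def Respects (p : CStarSeminorm (FreeStarAlgebra X)) : Prop :=
  ∀ a b, R a b → p (a - b) = 0

/-- The relations are admissible: they bound the generators, uniformly in all C*-seminorms that
respect them. -/
def Admissible : Prop :=
  ∀ x : X, ∃ C : ℝ, ∀ p : CStarSeminorm (FreeStarAlgebra X), p.Respects R →
    p (FreeStarAlgebra.gen x) ≤ C

variable {R}

theorem apply_one_le {A : Type u} [Ring A] [StarRing A] [Algebra ℂ A]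
    (p : CStarSeminorm A) : p 1 ≤ 1 := by
  have h := p.star_mul_self 1
  rw [star_one, one_mul] at h
  nlinarith [p.nonneg 1]

theorem Admissible.bdd (h : Admissible R) (a : FreeStarAlgebra X) :
    ∃ C : ℝ, 0 ≤ C ∧ ∀ p : CStarSeminorm (FreeStarAlgebra X), p.Respects R → p a ≤ C := by
  induction a using FreeStarAlgebra.induction with
  | h_alg r =>
    refine ⟨‖r‖, norm_nonneg r, fun p _ => ?_⟩
    rw [Algebra.algebraMap_eq_smul_one, map_smul_eq_mul]
    exact mul_le_of_le_one_right (norm_nonneg r) p.apply_one_le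
  | h_sym y =>
    rcases y with x | x
    · obtain ⟨C, hC⟩ := h x
      exact ⟨max C 0, le_max_right _ _, fun p hp => (hC p hp).trans (le_max_left _ _)⟩
    · obtain ⟨C, hC⟩ := h x
      refine ⟨max C 0, le_max_right _ _, fun p hp => le_trans ?_ (le_max_left C 0)⟩
      rw [← FreeStarAlgebra.star_gen, p.star_eq]
      exact hC p hp
  | h_mul a b ha hb =>
    obtain ⟨C, hC0, hC⟩ := ha
    obtain ⟨D, hD0, hD⟩ := hb
    exact ⟨C * D, mul_nonneg hC0 hD0, fun p hp => (p.mul_le a b).trans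
      (mul_le_mul (hC p hp) (hD p hp) (p.nonneg b) hC0)⟩
  | h_add a b ha hb =>
    obtain ⟨C, hC0, hC⟩ := ha
    obtain ⟨D, hD0, hD⟩ := hb
    exact ⟨C + D, add_nonneg hC0 hD0, fun p hp => (map_add_le_add p.toSeminorm a b).trans
      (add_le_add (hC p hp) (hD p hp))⟩

/-- The largest C*-seminorm on the free *-algebra that respects the relations. -/
def universal (h : Admissible R) : CStarSeminorm (FreeStarAlgebra X) :=
  iSup (fun p : {p : CStarSeminorm (FreeStarAlgebra X) // p.Respects R} => p.1) fun a => by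
    obtain ⟨C, -, hC⟩ := h.bdd a
    exact ⟨C, by rintro _ ⟨p, rfl⟩; exact hC p.1 p.2⟩

theorem le_universal (h : Admissible R) (p : CStarSeminorm (FreeStarAlgebra X))
    (hp : p.Respects R) (a : FreeStarAlgebra X) : p a ≤ universal h a := by
  obtain ⟨C, -, hC⟩ := h.bdd a
  exact le_ciSup (f := fun p : {p : CStarSeminorm (FreeStarAlgebra X) // p.Respects R} => p.1 a)
    ⟨C, by rintro _ ⟨p, rfl⟩; exact hC p.1 p.2⟩ ⟨p, hp⟩

theorem universal_respects (h : Admissible R) : (universal h).Respects R := by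
  intro a b hab
  refine (iSup_apply _ _ _).trans ?_
  have : ∀ p : {p : CStarSeminorm (FreeStarAlgebra X) // p.Respects R}, p.1 (a - b) = 0 :=
    fun p => p.2 a b hab
  simp [this]

/-- The C*-seminorm pulled back from a C*-algebra along a *-homomorphism. -/
def pullback {A : Type u} [Ring A] [StarRing A] [Algebra ℂ A] {B : Type v} [CStarAlgebra B]
    (f : A →⋆ₐ[ℂ] B) : CStarSeminorm A where
  toFun a := ‖f a‖
  map_zero' := by simp
  add_le' a b := by simpa using norm_add_le (f a) (f b)
  neg' a := by simp
  smul' r a := by rw [map_smul, norm_smul]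
  mul_le' a b := by simpa using norm_mul_le (f a) (f b)
  star_mul_self' a := by rw [map_mul, map_star, CStarRing.norm_star_mul_self]

end CStarSeminorm

/-- The universal unital C*-algebra with generators `x ∈ X` and relations `a = b` for `R a b`. -/
abbrev UniversalCStarAlgebra {X : Type u} {R : FreeStarAlgebra X → FreeStarAlgebra X → Prop}
    (h : CStarSeminorm.Admissible R) : Type u :=
  (CStarSeminorm.universal h).Completed

namespace UniversalCStarAlgebra

variable {X : Type u} {R : FreeStarAlgebra X → FreeStarAlgebra X → Prop}
  (h : CStarSeminorm.Admissible R)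

/-- The canonical *-homomorphism from the free *-algebra. -/
def mk : FreeStarAlgebra X →⋆ₐ[ℂ] UniversalCStarAlgebra h :=
  CStarSeminorm.Completed.of (CStarSeminorm.universal h)

/-- The generators. -/
def gen (x : X) : UniversalCStarAlgebra h := mk h (FreeStarAlgebra.gen x)

theorem mk_eq_of_rel {a b : FreeStarAlgebra X} (hab : R a b) : mk h a = mk h b := by
  rw [← sub_eq_zero, ← map_sub, ← norm_eq_zero]
  exact (CStarSeminorm.Completed.norm_of _ _).trans
    (CStarSeminorm.universal_respects h a b hab)

variable {B : Type v} [CStarAlgebra B]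

/-- The universal property: elements of a C*-algebra that satisfy the relations define a
*-homomorphism. -/
def lift (f : X → B)
    (hf : ∀ a b, R a b → FreeStarAlgebra.lift f a = FreeStarAlgebra.lift f b) :
    UniversalCStarAlgebra h →⋆ₐ[ℂ] B :=
  CStarSeminorm.Completed.lift _ (FreeStarAlgebra.lift f) fun a =>
    CStarSeminorm.le_universal h (CStarSeminorm.pullback (FreeStarAlgebra.lift f))
      (fun a b hab => by
        change ‖FreeStarAlgebra.lift f (a - b)‖ = 0
        rw [map_sub, hf a b hab, sub_self, norm_zero]) a

theorem lift_gen (f : X → B)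
    (hf : ∀ a b, R a b → FreeStarAlgebra.lift f a = FreeStarAlgebra.lift f b) (x : X) :
    lift h f hf (gen h x) = f x :=
  (CStarSeminorm.Completed.lift_of _ _ _ _).trans (FreeStarAlgebra.lift_gen f x)

end UniversalCStarAlgebra

/-! ### The minimal (spatial) tensor product of C*-algebras -/

/-- The algebraic tensor product of two Hilbert spaces, as an inner product space with
`⟪x ⊗ y, x' ⊗ y'⟫ = ⟪x, x'⟫ ⟪y, y'⟫`. (A bounded operator on it has the same norm as its extension
to the Hilbert space tensor product, which is the completion.) -/
def PreTensor (H K : Type u) [NormedAddCommGroup H] [InnerProductSpace ℂ H]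
    [NormedAddCommGroup K] [InnerProductSpace ℂ K] : Type u := H ⊗[ℂ] K

namespace PreTensor

variable {H K : Type u} [NormedAddCommGroup H] [InnerProductSpace ℂ H]
  [NormedAddCommGroup K] [InnerProductSpace ℂ K]

instance : NormedAddCommGroup (PreTensor H K) :=
  inferInstanceAs (NormedAddCommGroup (H ⊗[ℂ] K))

instance : InnerProductSpace ℂ (PreTensor H K) :=
  inferInstanceAs (InnerProductSpace ℂ (H ⊗[ℂ] K))

/-- The elementary tensor `x ⊗ y`. -/
def tmul (x : H) (y : K) : PreTensor H K := x ⊗ₜ[ℂ] y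

theorem inner_tmul (x x' : H) (y y' : K) :
    inner ℂ (tmul x y) (tmul x' y') = inner ℂ x x' * inner ℂ y y' :=
  TensorProduct.inner_tmul (𝕜 := ℂ) x x' y y'

theorem induction {P : PreTensor H K → Prop} (h0 : P 0) (ht : ∀ x y, P (tmul x y))
    (ha : ∀ x y, P x → P y → P (x + y)) (z : PreTensor H K) : P z :=
  TensorProduct.induction_on (motive := P) z h0 ht ha

/-- The bounded operator `S ⊗ T`. -/
def op (S : H →L[ℂ] H) (T : K →L[ℂ] K) : PreTensor H K →L[ℂ] PreTensor H K :=
  TensorProduct.mapL S T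

theorem norm_op_le (S : H →L[ℂ] H) (T : K →L[ℂ] K) : ‖op S T‖ ≤ ‖S‖ * ‖T‖ :=
  TensorProduct.norm_mapL_le S T

theorem op_tmul (S : H →L[ℂ] H) (T : K →L[ℂ] K) (x : H) (y : K) :
    op S T (tmul x y) = tmul (S x) (T y) := rfl

theorem op_one : op (1 : H →L[ℂ] H) (1 : K →L[ℂ] K) = 1 := TensorProduct.mapL_id_id

theorem op_mul (S S' : H →L[ℂ] H) (T T' : K →L[ℂ] K) :
    op (S * S') (T * T') = op S T * op S' T' := TensorProduct.mapL_mul S S' T T'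

theorem op_add_left (S S' : H →L[ℂ] H) (T : K →L[ℂ] K) : op (S + S') T = op S T + op S' T :=
  TensorProduct.mapL_add_left S S' T

theorem op_add_right (S : H →L[ℂ] H) (T T' : K →L[ℂ] K) : op S (T + T') = op S T + op S T' :=
  TensorProduct.mapL_add_right S T T'

theorem op_smul_left (r : ℂ) (S : H →L[ℂ] H) (T : K →L[ℂ] K) : op (r • S) T = r • op S T :=
  TensorProduct.mapL_smul_left r S T

theorem op_smul_right (r : ℂ) (S : H →L[ℂ] H) (T : K →L[ℂ] K) : op S (r • T) = r • op S T :=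
  TensorProduct.mapL_smul_right r S T

end PreTensor

/-- A pair of unital *-representations of `A` and `B` on Hilbert spaces `H` and `K`. (By the GNS
construction, representations on spaces in the universe of the algebras are sufficient to compute
norms.) -/
structure RepPair (A B : Type u) [CStarAlgebra A] [CStarAlgebra B] : Type (u + 1) where
  H : Type u
  K : Type u
  [normH : NormedAddCommGroup H]
  [innerH : InnerProductSpace ℂ H]
  [completeH : CompleteSpace H]
  [normK : NormedAddCommGroup K]
  [innerK : InnerProductSpace ℂ K]
  [completeK : CompleteSpace K]
  π : A →⋆ₐ[ℂ] (H →L[ℂ] H)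
  ρ : B →⋆ₐ[ℂ] (K →L[ℂ] K)

namespace RepPair

attribute [instance] normH innerH completeH normK innerK completeK

variable {A B : Type u} [CStarAlgebra A] [CStarAlgebra B] (σ : RepPair A B)

/-- The operators `π(a) ⊗ 1`. -/
def left : A →ₐ[ℂ] (PreTensor σ.H σ.K →L[ℂ] PreTensor σ.H σ.K) :=
  AlgHom.ofLinearMap
    { toFun := fun a => PreTensor.op (σ.π a) 1
      map_add' := fun a b => by rw [map_add, PreTensor.op_add_left]
      map_smul' := fun r a => by
        rw [map_smul, PreTensor.op_smul_left, RingHom.id_apply] }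
    (by simpa using PreTensor.op_one (H := σ.H) (K := σ.K))
    (fun a b => by simpa using PreTensor.op_mul (σ.π a) (σ.π b) (1 : σ.K →L[ℂ] σ.K) 1)

/-- The operators `1 ⊗ ρ(b)`. -/
def right : B →ₐ[ℂ] (PreTensor σ.H σ.K →L[ℂ] PreTensor σ.H σ.K) :=
  AlgHom.ofLinearMap
    { toFun := fun b => PreTensor.op 1 (σ.ρ b)
      map_add' := fun a b => by rw [map_add, PreTensor.op_add_right]
      map_smul' := fun r a => by
        rw [map_smul, PreTensor.op_smul_right, RingHom.id_apply] }
    (by simpa using PreTensor.op_one (H := σ.H) (K := σ.K))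
    (fun a b => by simpa using PreTensor.op_mul (1 : σ.H →L[ℂ] σ.H) 1 (σ.ρ a) (σ.ρ b))

/-- The representation `π ⊗ ρ` of the algebraic tensor product `A ⊙ B` on the (algebraic) tensor
product of the Hilbert spaces `H` and `K`, with its inner product. -/
def rep : A ⊗[ℂ] B →ₐ[ℂ] (PreTensor σ.H σ.K →L[ℂ] PreTensor σ.H σ.K) :=
  Algebra.TensorProduct.lift σ.left σ.right fun a b => by
    change PreTensor.op _ _ * PreTensor.op _ _ =
      PreTensor.op _ _ * PreTensor.op _ _
    rw [← PreTensor.op_mul, ← PreTensor.op_mul]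
    simp

theorem rep_tmul (a : A) (b : B) :
    σ.rep (a ⊗ₜ b) = PreTensor.op (σ.π a) (σ.ρ b) := by
  change PreTensor.op _ _ * PreTensor.op _ _ = _
  rw [← PreTensor.op_mul]
  simp

theorem inner_rep (x : A ⊗[ℂ] B) (ξ η : PreTensor σ.H σ.K) :
    inner ℂ (σ.rep (star x) ξ) η = inner ℂ ξ (σ.rep x η) := by
  induction x using TensorProduct.induction_on with
  | zero => simp
  | add x y hx hy => simp only [star_add, map_add, add_apply, inner_add_left, inner_add_right, hx, hy]
  | tmul a b =>
    rw [TensorProduct.star_tmul, rep_tmul, rep_tmul]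
    induction ξ using PreTensor.induction with
    | h0 => simp
    | ha ξ ζ h1 h2 => simp only [map_add, inner_add_left, h1, h2]
    | ht ξ ζ =>
      induction η using PreTensor.induction with
      | h0 => simp
      | ha η θ h1 h2 => simp only [map_add, inner_add_right, h1, h2]
      | ht η θ =>
        rw [PreTensor.op_tmul, PreTensor.op_tmul, PreTensor.inner_tmul,
          PreTensor.inner_tmul, map_star, map_star, ContinuousLinearMap.star_eq_adjoint,
          ContinuousLinearMap.star_eq_adjoint, ContinuousLinearMap.adjoint_inner_left,
          ContinuousLinearMap.adjoint_inner_left]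

theorem norm_rep_sq_le (x : A ⊗[ℂ] B) : ‖σ.rep x‖ * ‖σ.rep x‖ ≤ ‖σ.rep (star x * x)‖ := by
  have key : ‖σ.rep x‖ ≤ Real.sqrt ‖σ.rep (star x * x)‖ := by
    refine ContinuousLinearMap.opNorm_le_bound _ (Real.sqrt_nonneg _) fun ξ => ?_
    refine (sq_le_sq₀ (norm_nonneg _) (by positivity)).mp ?_
    rw [mul_pow, Real.sq_sqrt (norm_nonneg _), ← inner_self_eq_norm_sq (𝕜 := ℂ), ← inner_rep,
      ← mul_apply_eq_comp, ← map_mul]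
    calc RCLike.re (inner ℂ (σ.rep (star x * x) ξ) ξ)
        ≤ ‖σ.rep (star x * x) ξ‖ * ‖ξ‖ := re_inner_le_norm _ _
      _ ≤ (‖σ.rep (star x * x)‖ * ‖ξ‖) * ‖ξ‖ :=
          mul_le_mul_of_nonneg_right (ContinuousLinearMap.le_opNorm _ _) (norm_nonneg _)
      _ = _ := by ring
  calc _ ≤ Real.sqrt ‖σ.rep (star x * x)‖ * Real.sqrt ‖σ.rep (star x * x)‖ :=
        mul_le_mul key key (norm_nonneg _) (Real.sqrt_nonneg _)
    _ = _ := Real.mul_self_sqrt (norm_nonneg _)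

theorem norm_rep_le_star (x : A ⊗[ℂ] B) : ‖σ.rep x‖ ≤ ‖σ.rep (star x)‖ := by
  have h1 := σ.norm_rep_sq_le x
  rw [map_mul] at h1
  have h2 := norm_mul_le (σ.rep (star x)) (σ.rep x)
  rcases (norm_nonneg (σ.rep x)).eq_or_lt with h | h
  · rw [← h]; exact norm_nonneg _
  · nlinarith

/-- The C*-seminorm `x ↦ ‖(π ⊗ ρ)(x)‖` on the algebraic tensor product. -/
def seminorm : CStarSeminorm (A ⊗[ℂ] B) where
  toFun x := ‖σ.rep x‖
  map_zero' := by simp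
  add_le' a b := by simpa using norm_add_le (σ.rep a) (σ.rep b)
  neg' a := by simp
  smul' r a := by rw [map_smul, norm_smul]
  mul_le' a b := by simpa using norm_mul_le (σ.rep a) (σ.rep b)
  star_mul_self' x := by
    refine le_antisymm ?_ (σ.norm_rep_sq_le x)
    rw [map_mul]
    refine (norm_mul_le _ _).trans (mul_le_mul_of_nonneg_right ?_ (norm_nonneg _))
    simpa using σ.norm_rep_le_star (star x)

theorem seminorm_apply (x : A ⊗[ℂ] B) : σ.seminorm x = ‖σ.rep x‖ := rfl

theorem bdd (x : A ⊗[ℂ] B) : ∃ C : ℝ, ∀ σ : RepPair A B, σ.seminorm x ≤ C := by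
  induction x using TensorProduct.induction_on with
  | zero => exact ⟨0, fun σ => by simp⟩
  | add x y hx hy =>
    obtain ⟨C, hC⟩ := hx
    obtain ⟨D, hD⟩ := hy
    exact ⟨C + D, fun σ => (map_add_le_add σ.seminorm.toSeminorm x y).trans
      (add_le_add (hC σ) (hD σ))⟩
  | tmul a b =>
    refine ⟨‖a‖ * ‖b‖, fun σ => ?_⟩
    rw [seminorm_apply, rep_tmul]
    exact (PreTensor.norm_op_le _ _).trans (mul_le_mul
      (NonUnitalStarAlgHom.norm_apply_le σ.π a) (NonUnitalStarAlgHom.norm_apply_le σ.ρ b)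
      (norm_nonneg _) (norm_nonneg _))

end RepPair

section MinTensor

variable (A B : Type u) [CStarAlgebra A] [CStarAlgebra B]

/-- The spatial norm on the algebraic tensor product of two C*-algebras: the supremum of
`‖(π ⊗ ρ)(x)‖` over all pairs of representations `π` of `A` and `ρ` of `B`. -/
def spatialSeminorm : CStarSeminorm (A ⊗[ℂ] B) :=
  CStarSeminorm.iSup (fun σ : RepPair A B => σ.seminorm) fun x => by
    obtain ⟨C, hC⟩ := RepPair.bdd x
    exact ⟨C, by rintro _ ⟨σ, rfl⟩; exact hC σ⟩

/-- The minimal tensor product of two C*-algebras. -/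
abbrev MinTensor : Type u := (spatialSeminorm A B).Completed

end MinTensor

namespace MinTensor

variable {A B A' B' : Type u} [CStarAlgebra A] [CStarAlgebra B] [CStarAlgebra A']
  [CStarAlgebra B']

theorem seminorm_le (σ : RepPair A B) (x : A ⊗[ℂ] B) : σ.seminorm x ≤ spatialSeminorm A B x := by
  obtain ⟨C, hC⟩ := RepPair.bdd x
  exact le_ciSup (f := fun σ : RepPair A B => σ.seminorm x)
    ⟨C, by rintro _ ⟨σ, rfl⟩; exact hC σ⟩ σ

variable (A B) in
/-- The canonical *-homomorphism from the algebraic tensor product. -/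
def of : A ⊗[ℂ] B →⋆ₐ[ℂ] MinTensor A B :=
  CStarSeminorm.Completed.of (spatialSeminorm A B)

/-- The elementary tensor `a ⊗ b`. -/
def tmul (a : A) (b : B) : MinTensor A B := of A B (a ⊗ₜ b)

/-- The algebraic tensor product of two *-homomorphisms. -/
def algMap (φ : A →⋆ₐ[ℂ] A') (ψ : B →⋆ₐ[ℂ] B') : A ⊗[ℂ] B →⋆ₐ[ℂ] A' ⊗[ℂ] B' :=
  { Algebra.TensorProduct.map (φ : A →ₐ[ℂ] A') (ψ : B →ₐ[ℂ] B') with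
    map_star' := fun x => by
      change Algebra.TensorProduct.map (φ : A →ₐ[ℂ] A') (ψ : B →ₐ[ℂ] B') (star x) =
        star (Algebra.TensorProduct.map (φ : A →ₐ[ℂ] A') (ψ : B →ₐ[ℂ] B') x)
      induction x using TensorProduct.induction_on with
      | zero => simp
      | add x y hx hy => rw [star_add, map_add, hx, hy, map_add, star_add]
      | tmul a b => simp [TensorProduct.star_tmul, map_star] }

theorem algMap_tmul (φ : A →⋆ₐ[ℂ] A') (ψ : B →⋆ₐ[ℂ] B') (a : A) (b : B) :
    algMap φ ψ (a ⊗ₜ b) = φ a ⊗ₜ ψ b :=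
  Algebra.TensorProduct.map_tmul (φ : A →ₐ[ℂ] A') (ψ : B →ₐ[ℂ] B') a b

theorem spatialSeminorm_algMap_le (φ : A →⋆ₐ[ℂ] A') (ψ : B →⋆ₐ[ℂ] B') (x : A ⊗[ℂ] B) :
    spatialSeminorm A' B' (algMap φ ψ x) ≤ spatialSeminorm A B x := by
  refine Real.iSup_le (fun σ => ?_) ((spatialSeminorm A B).nonneg x)
  let τ : RepPair A B := { H := σ.H, K := σ.K, π := σ.π.comp φ, ρ := σ.ρ.comp ψ }
  have h : σ.rep (algMap φ ψ x) = τ.rep x := by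
    induction x using TensorProduct.induction_on with
    | zero => simp
    | add x y hx hy => rw [map_add, map_add, hx, hy, map_add]
    | tmul a b => rw [algMap_tmul, RepPair.rep_tmul, RepPair.rep_tmul]; rfl
  change ‖σ.rep (algMap φ ψ x)‖ ≤ _
  rw [h]
  exact seminorm_le τ x

/-- The tensor product `φ ⊗ ψ` of two *-homomorphisms. -/
def map (φ : A →⋆ₐ[ℂ] A') (ψ : B →⋆ₐ[ℂ] B') : MinTensor A B →⋆ₐ[ℂ] MinTensor A' B' :=
  CStarSeminorm.Completed.lift _ ((of A' B').comp (algMap φ ψ)) fun x =>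
    (CStarSeminorm.Completed.norm_of _ _).le.trans (spatialSeminorm_algMap_le φ ψ x)

theorem map_tmul (φ : A →⋆ₐ[ℂ] A') (ψ : B →⋆ₐ[ℂ] B') (a : A) (b : B) :
    map φ ψ (tmul a b) = tmul (φ a) (ψ b) :=
  (CStarSeminorm.Completed.lift_of _ _ _ _).trans
    (congrArg (of A' B') (algMap_tmul φ ψ a b))

end MinTensor

/-! ### Colored graphs and their quantum automorphism groups -/

/-- A vertex- and edge-colored graph: undirected, without loops or multiple edges; the vertices have
colors in `S` and the edges have colors in `T`. -/
structure ColoredGraph (V : Type u) (S : Type v) (T : Type w) where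
  graph : SimpleGraph V
  vertexColor : V → S
  edgeColor : graph.edgeSet → T

namespace ColoredGraph

variable {V : Type u} {S : Type v} {T : Type w}

/-- `i` and `j` are joined by an edge of color `c`. -/
def HasEdge (G : ColoredGraph V S T) (c : T) (i j : V) : Prop :=
  ∃ h : s(i, j) ∈ G.graph.edgeSet, G.edgeColor ⟨s(i, j), h⟩ = c

open Classical in
/-- The adjacency matrix of the edge color `c`. -/
def adjMatrix (G : ColoredGraph V S T) (c : T) (B : Type*) [Ring B] : Matrix V V B :=
  Matrix.of fun i j => if G.HasEdge c i j then 1 else 0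

/-- The matrix of the generators `u i j` of the free *-algebra. -/
def freeMatrix (V : Type u) : Matrix V V (FreeStarAlgebra (V × V)) :=
  Matrix.of fun i j => FreeStarAlgebra.gen (i, j)

/-- The defining relations of the quantum automorphism group. -/
inductive Rel [Fintype V] (G : ColoredGraph V S T) :
    FreeStarAlgebra (V × V) → FreeStarAlgebra (V × V) → Prop
  | star_eq (i j : V) : Rel G (star (freeMatrix V i j)) (freeMatrix V i j)
  | sq_eq (i j : V) : Rel G (freeMatrix V i j * freeMatrix V i j) (freeMatrix V i j)
  | row_sum (i : V) : Rel G (∑ l, freeMatrix V i l) 1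
  | col_sum (i : V) : Rel G (∑ l, freeMatrix V l i) 1
  | vertex_color (i j : V) (h : G.vertexColor i ≠ G.vertexColor j) : Rel G (freeMatrix V i j) 0
  | edge_color (c : T) (i j : V) :
      Rel G ((G.adjMatrix c (FreeStarAlgebra (V × V)) * freeMatrix V) i j)
        ((freeMatrix V * G.adjMatrix c (FreeStarAlgebra (V × V))) i j)

variable [Fintype V] (G : ColoredGraph V S T)

theorem admissible : CStarSeminorm.Admissible G.Rel := by
  rintro ⟨i, j⟩
  refine ⟨1, fun p hp => ?_⟩
  change p (freeMatrix V i j) ≤ 1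
  set a := freeMatrix V i j with ha
  have h1 : p (star a - a) = 0 := hp _ _ (Rel.star_eq i j)
  have h2 : p (a * a - a) = 0 := hp _ _ (Rel.sq_eq i j)
  have h3 : star a * a = (star a - a) * a + ((a * a - a) + a) := by noncomm_ring
  have h4 : p (star a * a) ≤ p a := by
    rw [h3]
    refine (map_add_le_add p.toSeminorm _ _).trans ?_
    have h5 := p.mul_le (star a - a) a
    have h6 := map_add_le_add p.toSeminorm (a * a - a) a
    rw [h1, zero_mul] at h5
    rw [h2, zero_add] at h6
    linarith
  rw [p.star_mul_self] at h4
  nlinarith [p.nonneg a]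

/-- The C*-algebra `C(Qut(G))` of the quantum automorphism group of `G`. -/
abbrev CQut : Type u := UniversalCStarAlgebra G.admissible

/-- The fundamental representation of `Qut(G)`: the matrix of the generators of `C(Qut(G))`. -/
def fundRep : Matrix V V G.CQut :=
  Matrix.of fun i j => UniversalCStarAlgebra.gen G.admissible (i, j)

/-- A matrix with entries in a *-ring satisfies the relations of the fundamental representation. -/
structure IsModel {B : Type*} [Ring B] [StarRing B] (v : Matrix V V B) : Prop where
  star_eq : ∀ i j, star (v i j) = v i j
  sq_eq : ∀ i j, v i j * v i j = v i j
  row_sum : ∀ i, ∑ l, v i l = 1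
  col_sum : ∀ i, ∑ l, v l i = 1
  vertex_color : ∀ i j, G.vertexColor i ≠ G.vertexColor j → v i j = 0
  edge_color : ∀ c, G.adjMatrix c B * v = v * G.adjMatrix c B

variable {G}

theorem map_adj_mul {B : Type*} {F : Type*} {C : Type*} [Ring B] [Ring C] [FunLike F B C]
    [RingHomClass F B C] (f : F) (c : T) (v : Matrix V V B) (i j : V) :
    f ((G.adjMatrix c B * v) i j) = (G.adjMatrix c C * v.map f) i j := by
  simp [Matrix.mul_apply, adjMatrix, apply_ite f]

theorem map_mul_adj {B : Type*} {F : Type*} {C : Type*} [Ring B] [Ring C] [FunLike F B C]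
    [RingHomClass F B C] (f : F) (c : T) (v : Matrix V V B) (i j : V) :
    f ((v * G.adjMatrix c B) i j) = (v.map f * G.adjMatrix c C) i j := by
  simp [Matrix.mul_apply, adjMatrix, apply_ite f]

variable (G)

theorem isModel_fundRep : G.IsModel G.fundRep := by
  have hm : ∀ i j, G.fundRep i j = UniversalCStarAlgebra.mk G.admissible (freeMatrix V i j) :=
    fun i j => rfl
  have hm' : G.fundRep = (freeMatrix V).map (UniversalCStarAlgebra.mk G.admissible) := rfl
  constructor
  · intro i j
    rw [hm, ← map_star]
    exact UniversalCStarAlgebra.mk_eq_of_rel _ (Rel.star_eq i j)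
  · intro i j
    rw [hm, ← map_mul]
    exact UniversalCStarAlgebra.mk_eq_of_rel _ (Rel.sq_eq i j)
  · intro i
    simp_rw [hm]
    rw [← map_sum, UniversalCStarAlgebra.mk_eq_of_rel _ (Rel.row_sum i), map_one]
  · intro i
    simp_rw [hm]
    rw [← map_sum, UniversalCStarAlgebra.mk_eq_of_rel _ (Rel.col_sum i), map_one]
  · intro i j h
    rw [hm, UniversalCStarAlgebra.mk_eq_of_rel _ (Rel.vertex_color i j h), map_zero]
  · intro c
    ext i j
    rw [hm', ← map_adj_mul, ← map_mul_adj]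
    exact UniversalCStarAlgebra.mk_eq_of_rel _ (Rel.edge_color c i j)

/-- The universal property of `C(Qut(G))`. -/
def liftModel {B : Type*} [CStarAlgebra B] (v : Matrix V V B) (hv : G.IsModel v) :
    G.CQut →⋆ₐ[ℂ] B :=
  UniversalCStarAlgebra.lift G.admissible (fun x => v x.1 x.2) (by
    have hm : ∀ i j, FreeStarAlgebra.lift (fun x : V × V => v x.1 x.2) (freeMatrix V i j) = v i j :=
      fun i j => FreeStarAlgebra.lift_gen _ _
    have hm' : (freeMatrix V).map (FreeStarAlgebra.lift (fun x : V × V => v x.1 x.2)) = v := by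
      ext i j; exact hm i j
    intro a b hab
    cases hab with
    | star_eq i j => rw [map_star, hm, hv.star_eq]
    | sq_eq i j => rw [map_mul, hm, hv.sq_eq]
    | row_sum i => rw [map_sum, map_one]; simp_rw [hm]; exact hv.row_sum i
    | col_sum i => rw [map_sum, map_one]; simp_rw [hm]; exact hv.col_sum i
    | vertex_color i j h => rw [hm, map_zero, hv.vertex_color i j h]
    | edge_color c i j => rw [map_adj_mul, map_mul_adj, hm', hv.edge_color])

theorem liftModel_fundRep {B : Type*} [CStarAlgebra B] (v : Matrix V V B) (hv : G.IsModel v)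
    (i j : V) : G.liftModel v hv (G.fundRep i j) = v i j :=
  UniversalCStarAlgebra.lift_gen _ _ _ _

/-- Projections in a C*-algebra that sum up to `1` are mutually orthogonal. -/
theorem mul_eq_zero_of_sum_eq_one {ι : Type*} [Fintype ι] {B : Type*} [CStarAlgebra B]
    (p : ι → B) (hs : ∀ k, star (p k) = p k) (hq : ∀ k, p k * p k = p k) (h1 : ∑ k, p k = 1)
    {k l : ι} (hkl : k ≠ l) : p k * p l = 0 := by
  classical
  let _ := CStarAlgebra.spectralOrder B
  have _ := CStarAlgebra.spectralOrderedRing B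
  have h2 : ∑ m ∈ Finset.univ.erase l, star (p m * p l) * (p m * p l) = 0 := by
    have h3 : ∀ m, star (p m * p l) * (p m * p l) = p l * p m * p l := fun m => by
      rw [star_mul, hs, hs, mul_assoc, ← mul_assoc (p m), hq, mul_assoc]
    simp_rw [h3]
    have h4 : ∑ m, p l * p m * p l = p l := by
      rw [← Finset.sum_mul, ← Finset.mul_sum, h1, mul_one, hq]
    rw [← Finset.add_sum_erase _ _ (Finset.mem_univ l), hq, hq] at h4
    simpa using h4
  rw [Finset.sum_eq_zero_iff_of_nonneg fun m _ => star_mul_self_nonneg _] at h2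
  exact (CStarRing.star_mul_self_eq_zero_iff _).mp
    (h2 k (Finset.mem_erase.mpr ⟨hkl, Finset.mem_univ k⟩))

/-- The matrix with entries `∑ k, u i k ⊗ u k j`. -/
def comulMatrix : Matrix V V (MinTensor G.CQut G.CQut) :=
  Matrix.of fun i j => ∑ k, MinTensor.tmul (G.fundRep i k) (G.fundRep k j)

theorem isModel_comulMatrix : G.IsModel G.comulMatrix := by
  have hu := G.isModel_fundRep
  have hm : ∀ i j, G.comulMatrix i j = MinTensor.of G.CQut G.CQut
      (∑ k, G.fundRep i k ⊗ₜ[ℂ] G.fundRep k j) := fun i j => (map_sum _ _ _).symm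
  constructor
  · intro i j
    rw [hm, ← map_star, star_sum]
    simp_rw [TensorProduct.star_tmul, hu.star_eq]
  · intro i j
    rw [hm, ← map_mul, Finset.sum_mul]
    congr 1
    refine Finset.sum_congr rfl fun k _ => ?_
    rw [Finset.mul_sum, Finset.sum_eq_single k]
    · rw [Algebra.TensorProduct.tmul_mul_tmul, hu.sq_eq, hu.sq_eq]
    · intro l _ hl
      rw [Algebra.TensorProduct.tmul_mul_tmul, mul_eq_zero_of_sum_eq_one (fun k => G.fundRep i k)
        (hu.star_eq i) (hu.sq_eq i) (hu.row_sum i) hl.symm, TensorProduct.zero_tmul]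
    · simp
  · intro i
    simp_rw [hm]
    rw [← map_sum, Finset.sum_comm]
    simp_rw [← TensorProduct.tmul_sum, hu.row_sum]
    rw [← TensorProduct.sum_tmul, hu.row_sum, ← Algebra.TensorProduct.one_def, map_one]
  · intro i
    simp_rw [hm]
    rw [← map_sum, Finset.sum_comm]
    simp_rw [← TensorProduct.sum_tmul, hu.col_sum]
    rw [← TensorProduct.tmul_sum, hu.col_sum, ← Algebra.TensorProduct.one_def, map_one]
  · intro i j hij
    rw [hm, Finset.sum_eq_zero, map_zero]
    intro k _
    by_cases h : G.vertexColor i = G.vertexColor k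
    · rw [hu.vertex_color k j (h ▸ hij), TensorProduct.tmul_zero]
    · rw [hu.vertex_color i k h, TensorProduct.zero_tmul]
  · intro c
    have h1 : ∀ i k, ∑ l, G.adjMatrix c ℂ i l • G.fundRep l k =
        ∑ l, G.adjMatrix c ℂ l k • G.fundRep i l := fun i k => by
      have := congrFun (congrFun (hu.edge_color c) i) k
      simp only [Matrix.mul_apply, adjMatrix, Matrix.of_apply, ite_mul, mul_ite, one_mul, mul_one,
        zero_mul, mul_zero] at this
      simpa [adjMatrix, ite_smul] using this
    have h2 : ∀ i j, (G.adjMatrix c (MinTensor G.CQut G.CQut) * G.comulMatrix) i j =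
        MinTensor.of G.CQut G.CQut
          (∑ l, ∑ k, (G.adjMatrix c ℂ i l • G.fundRep l k) ⊗ₜ[ℂ] G.fundRep k j) := fun i j => by
      rw [Matrix.mul_apply, map_sum]
      refine Finset.sum_congr rfl fun l _ => ?_
      rw [hm]
      simp only [adjMatrix, Matrix.of_apply]
      split_ifs <;> simp
    have h3 : ∀ i j, (G.comulMatrix * G.adjMatrix c (MinTensor G.CQut G.CQut)) i j =
        MinTensor.of G.CQut G.CQut
          (∑ l, ∑ k, G.fundRep i k ⊗ₜ[ℂ] (G.adjMatrix c ℂ l j • G.fundRep k l)) := fun i j => by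
      rw [Matrix.mul_apply, map_sum]
      refine Finset.sum_congr rfl fun l _ => ?_
      rw [hm]
      simp only [adjMatrix, Matrix.of_apply]
      split_ifs <;> simp
    ext i j
    rw [h2, h3]
    congr 1
    rw [Finset.sum_comm]
    simp_rw [← TensorProduct.sum_tmul, h1, TensorProduct.sum_tmul, TensorProduct.smul_tmul]
    rw [Finset.sum_comm]
    simp_rw [← TensorProduct.tmul_sum, h1]
    rw [Finset.sum_comm]
    simp_rw [← TensorProduct.tmul_sum]

/-- The comultiplication of `Qut(G)`: the *-homomorphism `C(Qut(G)) → C(Qut(G)) ⊗ C(Qut(G))` with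
`u i j ↦ ∑ k, u i k ⊗ u k j`. -/
def comul : G.CQut →⋆ₐ[ℂ] MinTensor G.CQut G.CQut :=
  G.liftModel G.comulMatrix G.isModel_comulMatrix

theorem comul_fundRep (i j : V) :
    G.comul (G.fundRep i j) = ∑ k, MinTensor.tmul (G.fundRep i k) (G.fundRep k j) :=
  G.liftModel_fundRep _ _ i j

end ColoredGraph

/-! ### Replacing vertex colors by attached paths -/

namespace ColoredGraph

variable {V : Type u} {S : Type v} {T : Type w}

/-- The graph obtained from `G` by attaching to every vertex `v` a path with `n (c v)` edges, where
`c v` is the color of `v`. The vertices of the path at `v` are `⟨v, 0⟩, …, ⟨v, n (c v)⟩`, and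
`⟨v, 0⟩` is identified with `v`. -/
def pathGraph (G : ColoredGraph V S T) (n : S → ℕ) :
    SimpleGraph (Σ v : V, Fin (n (G.vertexColor v) + 1)) where
  Adj x y := (G.graph.Adj x.1 y.1 ∧ x.2.val = 0 ∧ y.2.val = 0) ∨
    (x.1 = y.1 ∧ (x.2.val + 1 = y.2.val ∨ y.2.val + 1 = x.2.val))
  symm := ⟨by
    rintro x y (⟨h, hx, hy⟩ | ⟨h, h'⟩)
    · exact Or.inl ⟨h.symm, hy, hx⟩
    · exact Or.inr ⟨h.symm, h'.symm⟩⟩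
  loopless := ⟨by
    rintro x (⟨h, -, -⟩ | ⟨-, h⟩)
    · exact G.graph.loopless.irrefl _ h
    · omega⟩

open Classical in
/-- The graph with attached paths, without vertex colors (all vertices have the same color): the
edges of `G` keep their colors, and all edges of the paths have the color `c₀`. (The edges of `G` are
those whose projection to `V` is an edge of `G`; the edges of the path at `v` are projected to the
pair `{v, v}`.) -/
def attachPaths (G : ColoredGraph V S T) (n : S → ℕ) (c₀ : T) :
    ColoredGraph (Σ v : V, Fin (n (G.vertexColor v) + 1)) Unit T where
  graph := G.pathGraph n
  vertexColor _ := ()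
  edgeColor e := if h : e.1.map Sigma.fst ∈ G.graph.edgeSet then G.edgeColor ⟨_, h⟩ else c₀

end ColoredGraph

end

/-! Homomorphisms from C(Qut(G)) to a C*-algebra correspond to matrices satisfying its relations
("models"), so the theorem amounts to a bijection between the models of G and those of the graph
with attached paths. One direction keeps the block of a model at the roots; the other repeats a
model of G on every level, the level of `⟨v, k⟩` being `k`.

The main point is that a nonzero entry `U x y` forces `x` and `y` to have the same level. Quantum
automorphisms respect neighbor counts: if nonzero entries preserve a property, they preserve the
number of neighbors with it (`IsModel.ncard_neighbors_eq`). Because degrees in G are at least 3, the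
roots are exactly the vertices with at least three neighbors, and each further level is recognized
by its adjacency to the previous one (`IsModel.level_eq`).

Now compare `A U` and `U A` at the entry `(⟨v, k⟩, ⟨w, k + 1⟩)`. If both paths reach level `k + 1`,
the entries of `U` at levels `k` and `k + 1` agree; if the path at `v` stops at `k`, the entry at
level `k` is zero. Hence every level repeats the root block, and a root entry vanishes when the path
lengths differ. As `n` separates the colors, this is the vertex color relation of G. The two
constructions are therefore inverse to each other, and the comultiplications match because a row of
a root is supported on roots. -/

noncomputable section

/-! ### Homomorphisms out of a universal C*-algebra -/

namespace UniversalCStarAlgebra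

variable {X : Type u} {R : FreeStarAlgebra X → FreeStarAlgebra X → Prop}
  {h : CStarSeminorm.Admissible R} {B : Type v} [CStarAlgebra B]

/-- Two *-homomorphisms on a universal C*-algebra agree if they agree on the generators. -/
theorem hom_ext {f g : UniversalCStarAlgebra h →⋆ₐ[ℂ] B} (hfg : ∀ x, f (gen h x) = g (gen h x)) :
    f = g := by
  have hmk : ∀ a : FreeStarAlgebra X, f (mk h a) = g (mk h a) := fun a => by
    induction a using FreeStarAlgebra.induction with
    | h_alg r => rw [AlgHomClass.commutes, AlgHomClass.commutes, AlgHomClass.commutes]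
    | h_sym y =>
      rcases y with x | x
      · exact hfg x
      · rw [← FreeStarAlgebra.star_gen, map_star, map_star, map_star]
        exact congrArg star (hfg x)
    | h_mul a b ha hb => rw [map_mul, map_mul, map_mul, ha, hb]
    | h_add a b ha hb => rw [map_add, map_add, map_add, ha, hb]
  -- A *-homomorphism of C*-algebras is contractive, so agreement on the dense image of the free
  -- *-algebra suffices.
  have hcont : ∀ k : UniversalCStarAlgebra h →⋆ₐ[ℂ] B, Continuous k := fun k =>
    AddMonoidHomClass.continuous_of_bound k 1 fun x => by
      rw [one_mul]; exact NonUnitalStarAlgHom.norm_apply_le k x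
  ext x
  exact CStarSeminorm.Completed.induction_on _ x (isClosed_eq (hcont f) (hcont g)) hmk

end UniversalCStarAlgebra

/-! ### Models and the neighbor counts they preserve -/

namespace ColoredGraph

variable {V : Type u} {S : Type v} {T : Type w}

theorem HasEdge.adj {G : ColoredGraph V S T} {c : T} {i j : V} (h : G.HasEdge c i j) :
    G.graph.Adj i j := h.1

theorem hasEdge_comm {G : ColoredGraph V S T} {c : T} {i j : V} :
    G.HasEdge c i j ↔ G.HasEdge c j i := by
  simp only [HasEdge, Sym2.eq_swap (a := i)]

section Model

variable [Fintype V] {G : ColoredGraph V S T} {B : Type*} [CStarAlgebra B] {U : Matrix V V B}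

theorem CQut.hom_ext {f g : G.CQut →⋆ₐ[ℂ] B}
    (hfg : ∀ i j, f (G.fundRep i j) = g (G.fundRep i j)) : f = g :=
  UniversalCStarAlgebra.hom_ext fun x => hfg x.1 x.2

theorem IsModel.mul_eq_zero_of_ne (hU : G.IsModel U) {i k l : V} (hkl : k ≠ l) :
    U i k * U i l = 0 :=
  mul_eq_zero_of_sum_eq_one (U i) (hU.star_eq i) (hU.sq_eq i) (hU.row_sum i) hkl

open Classical in
theorem adjMatrix_mul_apply (c : T) (M : Matrix V V B) (i j : V) :
    (G.adjMatrix c B * M) i j = ∑ l, if G.HasEdge c i l then M l j else 0 := by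
  simp [Matrix.mul_apply, adjMatrix]

open Classical in
theorem mul_adjMatrix_apply (c : T) (M : Matrix V V B) (i j : V) :
    (M * G.adjMatrix c B) i j = ∑ l, if G.HasEdge c l j then M i l else 0 := by
  simp [Matrix.mul_apply, adjMatrix]

open Classical in
theorem IsModel.sum_hasEdge (hU : G.IsModel U) (c : T) (i j : V) :
    (∑ l, if G.HasEdge c i l then U l j else 0) = ∑ l, if G.HasEdge c l j then U i l else 0 := by
  rw [← adjMatrix_mul_apply, ← mul_adjMatrix_apply, hU.edge_color]

open Classical in
/-- The entries of a model commute with the adjacency matrix of the uncolored graph. -/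
theorem IsModel.sum_adj (hU : G.IsModel U) (i j : V) :
    (∑ l, if G.graph.Adj i l then U l j else 0) = ∑ l, if G.graph.Adj l j then U i l else 0 := by
  -- `T` may be infinite, so the sum runs over the colors that occur; each edge has exactly one of
  -- them.
  have key : ∀ (k l : V) (b : B),
      (∑ c ∈ Finset.univ.image G.edgeColor, if G.HasEdge c k l then b else 0) =
        if G.graph.Adj k l then b else 0 := fun k l b => by
    split_ifs with h
    · have h' : ∀ c, G.HasEdge c k l ↔ G.edgeColor ⟨s(k, l), h⟩ = c := fun c =>
        ⟨fun ⟨_, hc⟩ => hc, fun hc => ⟨h, hc⟩⟩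
      simp only [h', Finset.sum_ite_eq]
      exact if_pos (Finset.mem_image_of_mem _ (Finset.mem_univ _))
    · exact Finset.sum_eq_zero fun c _ => if_neg fun hc => h hc.adj
  simp_rw [← key]
  rw [Finset.sum_comm, Finset.sum_comm (s := Finset.univ)]
  exact Finset.sum_congr rfl fun c _ => hU.sum_hasEdge c i j

/-- Adjacency matrices are symmetric with central entries 0 and 1, so the relations do not
distinguish rows from columns. -/
theorem IsModel.transpose (hU : G.IsModel U) : G.IsModel U.transpose where
  star_eq i j := hU.star_eq j i
  sq_eq i j := hU.sq_eq j i
  row_sum := hU.col_sum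
  col_sum := hU.row_sum
  vertex_color i j h := hU.vertex_color j i h.symm
  edge_color c := by
    classical
    ext i j
    rw [adjMatrix_mul_apply, mul_adjMatrix_apply]
    refine Eq.trans (Finset.sum_congr rfl fun l _ => if_congr hasEdge_comm rfl rfl)
      ((hU.sum_hasEdge c j i).symm.trans
        (Finset.sum_congr rfl fun l _ => if_congr hasEdge_comm rfl rfl))

open Classical in
/-- If the nonvanishing entries of a model preserve a property of vertices, then they preserve
the number of neighbors with this property. -/
theorem IsModel.ncard_neighbors_eq (hU : G.IsModel U) {p : V → Prop}
    (hp : ∀ x y, U x y ≠ 0 → (p x ↔ p y)) {x y : V} (hxy : U x y ≠ 0) :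
    {z | G.graph.Adj x z ∧ p z}.ncard = {z | G.graph.Adj y z ∧ p z}.ncard := by
  set f : V → ℕ := fun x => {z | G.graph.Adj x z ∧ p z}.ncard with hf
  -- `U` fixes the indicator vector of `p`: row `y` is supported where `p` has the value `p y`, and
  -- it sums to 1.
  have hfix : ∀ y, (∑ z, if p z then U y z else 0) = if p y then 1 else 0 := fun y => by
    have h : ∀ z, (if p z then U y z else 0) = if p y then U y z else 0 := fun z => by
      by_cases hz : U y z = 0
      · simp only [hz, ite_self]
      · simp only [hp y z hz]
    simp_rw [h, ← hU.row_sum y]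
    split_ifs
    · rfl
    · exact Finset.sum_const_zero
  -- With `A` the uncolored adjacency matrix, `f = A 1_p`, so `U f = U A 1_p = A U 1_p = A 1_p = f`.
  have hsum : ∑ y, U x y * (f y : B) = f x := by
    have h1 : ∀ y, (f y : B) = ∑ z, if G.graph.Adj y z ∧ p z then 1 else 0 := fun y => by
      simp [hf, Set.ncard_eq_toFinset_card']
    simp_rw [h1, Finset.mul_sum, mul_ite, mul_one, mul_zero]
    rw [Finset.sum_comm]
    calc (∑ z, ∑ y, if G.graph.Adj y z ∧ p z then U x y else 0)
        = ∑ z, ∑ y, if G.graph.Adj x y ∧ p z then U y z else 0 := by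
          refine Finset.sum_congr rfl fun z _ => ?_
          by_cases h : p z
          · simp only [h, and_true, hU.sum_adj]
          · simp only [h, and_false, if_false]
      _ = ∑ y, if G.graph.Adj x y then (∑ z, if p z then U y z else 0) else 0 := by
          rw [Finset.sum_comm]
          refine Finset.sum_congr rfl fun y _ => ?_
          by_cases h : G.graph.Adj x y
          · simp only [h, true_and, if_true]
          · simp only [h, false_and, if_false, Finset.sum_const_zero]
      _ = _ := by simp_rw [hfix, ite_and]
  -- Multiplying row `x` of `U f = f` on the left by `U x y` isolates one term, as the projections
  -- in a row are orthogonal.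
  have h2 : U x y * (f y : B) = U x y * (f x : B) := by
    rw [← hsum, Finset.mul_sum, Finset.sum_eq_single y]
    · rw [← mul_assoc, hU.sq_eq]
    · intro z _ hz
      rw [← mul_assoc, hU.mul_eq_zero_of_ne hz.symm, zero_mul]
    · simp
  have h3 : (f y : ℂ) • U x y = (f x : ℂ) • U x y := by
    simpa only [Nat.cast_smul_eq_nsmul, nsmul_eq_mul'] using h2
  exact_mod_cast (smul_left_injective ℂ hxy h3).symm

end Model

/-! ### Attached paths and the preservation of levels -/

section AttachPaths

variable (G : ColoredGraph V S T) (n : S → ℕ) (c₀ : T)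

/-- The vertex of the graph with attached paths that corresponds to the vertex `v`. -/
def root (v : V) : Σ v : V, Fin (n (G.vertexColor v) + 1) := ⟨v, 0⟩

theorem hasEdge_attachPaths {c : T} {x y : Σ v : V, Fin (n (G.vertexColor v) + 1)} :
    (G.attachPaths n c₀).HasEdge c x y ↔
      (G.HasEdge c x.1 y.1 ∧ x.2.val = 0 ∧ y.2.val = 0) ∨
      (c = c₀ ∧ x.1 = y.1 ∧ (x.2.val + 1 = y.2.val ∨ y.2.val + 1 = x.2.val)) := by
  constructor
  · rintro ⟨h, hc⟩
    rcases (show (G.pathGraph n).Adj x y from h) with ⟨h1, hx, hy⟩ | ⟨h1, h2⟩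
    · refine Or.inl ⟨⟨h1, ?_⟩, hx, hy⟩
      rw [← hc]
      symm
      exact dif_pos h1
    · refine Or.inr ⟨?_, h1, h2⟩
      rw [← hc]
      -- A path edge projects to a diagonal pair, which is no edge of the loopless graph G, so its
      -- color is the default `c₀`.
      exact dif_neg fun h3 => G.graph.ne_of_adj h3 h1
  · rintro (⟨⟨h, hc⟩, hx, hy⟩ | ⟨hc, h1, h2⟩)
    · exact ⟨Or.inl ⟨h, hx, hy⟩, by rw [← hc]; exact dif_pos h⟩
    · exact ⟨Or.inr ⟨h1, h2⟩, by rw [hc]; exact dif_neg fun h3 => G.graph.ne_of_adj h3 h1⟩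

variable {G n c₀}

theorem hasEdge_attachPaths_root {c : T} {v w : V} :
    (G.attachPaths n c₀).HasEdge c (root G n v) (root G n w) ↔ G.HasEdge c v w := by
  rw [hasEdge_attachPaths]
  simp [root]

variable {B : Type*} [CStarAlgebra B]

/-- The restriction to the roots of the paths of a matrix indexed by the vertices of the graph with
attached paths. -/
def restrictRoots (U : Matrix (Σ v : V, Fin (n (G.vertexColor v) + 1))
    (Σ v : V, Fin (n (G.vertexColor v) + 1)) B) : Matrix V V B :=
  U.submatrix (root G n) (root G n)

/-- The extension of a matrix indexed by the vertices of `G` that identifies the vertices of the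
same level on any two attached paths. -/
def extendLevels (G : ColoredGraph V S T) (n : S → ℕ) (u : Matrix V V B) :
    Matrix (Σ v : V, Fin (n (G.vertexColor v) + 1)) (Σ v : V, Fin (n (G.vertexColor v) + 1)) B :=
  Matrix.of fun x y => if x.2.val = y.2.val then u x.1 y.1 else 0

theorem extendLevels_root (u : Matrix V V B) (v w : V) :
    extendLevels G n u (root G n v) (root G n w) = u v w := by
  simp [extendLevels, root]

variable [Fintype V] {U : Matrix (Σ v : V, Fin (n (G.vertexColor v) + 1))
  (Σ v : V, Fin (n (G.vertexColor v) + 1)) B}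

/-- Off the roots a vertex has at most its two path neighbors, while a root keeps all its neighbors
in G. This is where the degree bound enters. -/
theorem three_le_ncard_neighbors_iff [DecidableRel G.graph.Adj]
    (hdeg : ∀ v : V, 3 ≤ G.graph.degree v) (x : Σ v : V, Fin (n (G.vertexColor v) + 1)) :
    3 ≤ {z | (G.pathGraph n).Adj x z}.ncard ↔ x.2.val = 0 := by
  constructor
  · intro h
    by_contra hx
    -- All neighbors of a non-root lie on its own path, where the level determines the vertex.
    have h1 : {z | (G.pathGraph n).Adj x z}.ncard ≤ ({x.2.val - 1, x.2.val + 1} : Set ℕ).ncard := by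
      refine Set.ncard_le_ncard_of_injOn (fun z => z.2.val) ?_ ?_
      · rintro z (⟨-, hz, -⟩ | ⟨-, hz⟩)
        · exact absurd hz hx
        · simp only [Set.mem_insert_iff, Set.mem_singleton_iff]
          omega
      · rintro ⟨v, k⟩ (⟨-, hz, -⟩ | ⟨rfl, -⟩)
        · exact absurd hz hx
        · rintro ⟨v', k'⟩ (⟨-, hz, -⟩ | ⟨h', -⟩) hk
          · exact absurd hz hx
          · change x.1 = v' at h'
            subst h'
            exact congrArg _ (Fin.ext hk)
    have h2 := Set.ncard_insert_le (x.2.val - 1) {x.2.val + 1}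
    rw [Set.ncard_singleton] at h2
    omega
  · intro hx
    refine (hdeg x.1).trans ?_
    rw [← SimpleGraph.card_neighborFinset_eq_degree, ← Set.ncard_coe_finset]
    refine Set.ncard_le_ncard_of_injOn (root G n) ?_ fun w _ w' _ h => congrArg Sigma.fst h
    intro w hw
    exact Or.inl ⟨(G.graph.mem_neighborFinset x.1 w).mp hw, hx, rfl⟩

/-- Each level is characterized by neighbor counts relative to the lower ones, so strong induction
on the level applies `IsModel.ncard_neighbors_eq` with "having level `k`" as the property. -/
theorem IsModel.level_eq [DecidableRel G.graph.Adj] (hdeg : ∀ v : V, 3 ≤ G.graph.degree v)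
    (hU : (G.attachPaths n c₀).IsModel U) {x y : Σ v : V, Fin (n (G.vertexColor v) + 1)}
    (hxy : U x y ≠ 0) : x.2.val = y.2.val := by
  suffices key : ∀ k, ∀ x y, U x y ≠ 0 → (x.2.val = k ↔ y.2.val = k) from
    ((key _ x y hxy).mp rfl).symm
  intro k
  induction k using Nat.strong_induction_on with
  | _ k ih =>
  rcases k with _ | k
  · intro x y hxy
    rw [← three_le_ncard_neighbors_iff hdeg x, ← three_le_ncard_neighbors_iff hdeg y]
    have h := hU.ncard_neighbors_eq (p := fun _ => True) (fun _ _ _ => Iff.rfl) hxy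
    simp only [and_true] at h
    exact iff_of_eq (congrArg (3 ≤ ·) h)
  · -- Among the vertices of level `> k`, those of level `k + 1` have a neighbor of level `k`.
    have key : ∀ x : Σ v : V, Fin (n (G.vertexColor v) + 1), x.2.val = k + 1 ↔ k < x.2.val ∧
        {z | (G.attachPaths n c₀).graph.Adj x z ∧ z.2.val = k}.ncard ≠ 0 := by
      intro x
      rw [← Nat.pos_iff_ne_zero, Set.ncard_pos]
      constructor
      · intro hx
        exact ⟨by omega, ⟨x.1, k, by have := x.2.isLt; omega⟩, Or.inr ⟨rfl, Or.inr hx.symm⟩, rfl⟩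
      · rintro ⟨hx, z, hz1, hz2⟩
        simp only [attachPaths, pathGraph] at hz1
        omega
    intro x y hxy
    rw [key, key, hU.ncard_neighbors_eq (p := fun z => z.2.val = k) (ih k (by omega)) hxy]
    -- Strong induction is needed here: agreement on all levels `≤ k` makes "level `> k`" an
    -- invariant too.
    have h : ∀ j ≤ k, x.2.val = j ↔ y.2.val = j := fun j hj => ih j (by omega) x y hxy
    have h1 := h x.2.val
    have h2 := h y.2.val
    have h3 : k < x.2.val ↔ k < y.2.val := by omega
    rw [h3]

/-! ### Propagation of entries along the paths -/

open Classical in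
-- In `U A` only `⟨w, k⟩` survives, being the sole neighbor of `⟨w, k + 1⟩` on level `k`. The path
-- at `v` need only reach level `k`: whether it continues decides between `IsModel.succ_level_eq`
-- and `IsModel.root_eq_zero_of_lt`.
theorem IsModel.sum_neighbors_eq
    (hU : (G.attachPaths n c₀).IsModel U) (hlevel : ∀ {x y}, U x y ≠ 0 → x.2.val = y.2.val)
    (v w : V) (k : ℕ) (hv : k < n (G.vertexColor v) + 1)
    (hw : k + 1 < n (G.vertexColor w) + 1) :
    (∑ z, if (G.pathGraph n).Adj ⟨v, k, hv⟩ z then U z ⟨w, k + 1, hw⟩ else 0) =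
      U ⟨v, k, hv⟩ ⟨w, k, by omega⟩ := by
  refine (hU.sum_adj _ _).trans ?_
  rw [Finset.sum_eq_single ⟨w, k, by omega⟩]
  · exact if_pos (Or.inr ⟨rfl, Or.inl rfl⟩)
  · rintro ⟨w', k'⟩ - hz
    split_ifs with hadj
    · by_contra h
      have hk : k = k'.val := hlevel h
      rcases hadj with ⟨-, -, h0⟩ | ⟨h1, -⟩
      · exact Nat.succ_ne_zero k h0
      · change w' = w at h1
        subst h1
        exact hz (congrArg _ (Fin.ext hk.symm))
    · rfl
  · simp

/-- The sum in `IsModel.sum_neighbors_eq` also has a single term, since `⟨v, k + 1⟩` is the only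
neighbor of `⟨v, k⟩` on level `k + 1`. -/
theorem IsModel.succ_level_eq
    (hU : (G.attachPaths n c₀).IsModel U) (hlevel : ∀ {x y}, U x y ≠ 0 → x.2.val = y.2.val)
    (v w : V) (k : ℕ) (hv : k + 1 < n (G.vertexColor v) + 1)
    (hw : k + 1 < n (G.vertexColor w) + 1) :
    U ⟨v, k + 1, hv⟩ ⟨w, k + 1, hw⟩ = U ⟨v, k, by omega⟩ ⟨w, k, by omega⟩ := by
  classical
  rw [← hU.sum_neighbors_eq hlevel v w k (by omega) hw, Finset.sum_eq_single ⟨v, k + 1, hv⟩]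
  · exact (if_pos (Or.inr ⟨rfl, Or.inl rfl⟩)).symm
  · rintro ⟨v', k'⟩ - hz
    split_ifs with hadj
    · by_contra h
      have hk : k'.val = k + 1 := hlevel h
      rcases hadj with ⟨-, -, h0⟩ | ⟨h1, -⟩
      · exact Nat.succ_ne_zero k (hk.symm.trans h0)
      · change v = v' at h1
        subst h1
        exact hz (congrArg _ (Fin.ext hk))
    · rfl
  · simp

theorem IsModel.level_eq_root
    (hU : (G.attachPaths n c₀).IsModel U) (hlevel : ∀ {x y}, U x y ≠ 0 → x.2.val = y.2.val)
    (v w : V) (k : ℕ) (hv : k < n (G.vertexColor v) + 1)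
    (hw : k < n (G.vertexColor w) + 1) :
    U ⟨v, k, hv⟩ ⟨w, k, hw⟩ = U (root G n v) (root G n w) := by
  induction k with
  | zero => rfl
  | succ k ih => rw [hU.succ_level_eq hlevel, ih]

/-- The root entry equals the entry at the last level of the path at `v`. No neighbor of that end
vertex lies one level higher, so every term in `IsModel.sum_neighbors_eq` vanishes. -/
theorem IsModel.root_eq_zero_of_lt
    (hU : (G.attachPaths n c₀).IsModel U) (hlevel : ∀ {x y}, U x y ≠ 0 → x.2.val = y.2.val)
    (v w : V) (h : n (G.vertexColor v) < n (G.vertexColor w)) :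
    U (root G n v) (root G n w) = 0 := by
  classical
  rw [← hU.level_eq_root hlevel v w (n (G.vertexColor v)) (by omega) (by omega),
    ← hU.sum_neighbors_eq hlevel v w _ (by omega) (by omega)]
  refine Finset.sum_eq_zero fun z _ => ?_
  split_ifs with hadj
  · by_contra h
    have hk : z.2.val = n (G.vertexColor v) + 1 := hlevel h
    rcases hadj with ⟨-, -, h0⟩ | ⟨h1, -⟩
    · omega
    · change v = z.1 at h1
      have h2 : z.2.val < n (G.vertexColor z.1) + 1 := z.2.isLt
      exact absurd (hk ▸ h2) (by rw [h1]; exact lt_irrefl _)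
  · rfl

theorem IsModel.root_eq_zero_of_ne
    (hU : (G.attachPaths n c₀).IsModel U) (hlevel : ∀ {x y}, U x y ≠ 0 → x.2.val = y.2.val)
    (v w : V) (h : n (G.vertexColor v) ≠ n (G.vertexColor w)) :
    U (root G n v) (root G n w) = 0 := by
  rcases h.lt_or_gt with h | h
  · exact hU.root_eq_zero_of_lt hlevel v w h
  · exact hU.transpose.root_eq_zero_of_lt (fun h => (hlevel h).symm) w v h

/-! ### Restriction and extension of models -/

theorem sum_eq_sum_root (f : (Σ v : V, Fin (n (G.vertexColor v) + 1)) → B)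
    (hf : ∀ x, x.2.val ≠ 0 → f x = 0) : ∑ x, f x = ∑ v, f (root G n v) := by
  rw [Fintype.sum_sigma]
  refine Finset.sum_congr rfl fun v _ => Finset.sum_eq_single 0 (fun k _ hk => hf _ ?_) (by simp)
  exact fun h => hk (Fin.ext h)

/-- Each path meets level `k` at most once; `hg` says that paths too short to meet it contribute
nothing. -/
theorem sum_level_eq_sum (k : ℕ) (g : V → B) (hg : ∀ v, g v ≠ 0 → k < n (G.vertexColor v) + 1) :
    (∑ x : Σ v : V, Fin (n (G.vertexColor v) + 1), if x.2.val = k then g x.1 else 0) =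
      ∑ v, g v := by
  rw [Fintype.sum_sigma]
  refine Finset.sum_congr rfl fun v _ => ?_
  by_cases hv : g v = 0
  · simp [hv]
  · rw [Finset.sum_eq_single ⟨k, hg v hv⟩]
    · exact if_pos rfl
    · exact fun m _ hm => if_neg fun h => hm (Fin.ext h)
    · simp

/-- Rows and columns of roots are supported on roots, so sums restrict. Injectivity of `n` on the
colors in use turns different colors into different path lengths. -/
theorem isModel_restrictRoots (hU : (G.attachPaths n c₀).IsModel U)
    (hlevel : ∀ {x y}, U x y ≠ 0 → x.2.val = y.2.val)
    (hn : Set.InjOn n (Set.range G.vertexColor)) : G.IsModel (restrictRoots U) where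
  star_eq _ _ := hU.star_eq _ _
  sq_eq _ _ := hU.sq_eq _ _
  row_sum v := by
    rw [← hU.row_sum (root G n v)]
    refine (sum_eq_sum_root (fun x => U (root G n v) x) fun x hx => ?_).symm
    by_contra h
    exact hx (hlevel h).symm
  col_sum v := by
    rw [← hU.col_sum (root G n v)]
    refine (sum_eq_sum_root (fun x => U x (root G n v)) fun x hx => ?_).symm
    by_contra h
    exact hx (hlevel h)
  vertex_color v w h := hU.root_eq_zero_of_ne hlevel v w fun h' =>
    h (hn (Set.mem_range_self v) (Set.mem_range_self w) h')
  edge_color c := by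
    classical
    ext v w
    have h := hU.sum_hasEdge c (root G n v) (root G n w)
    rw [sum_eq_sum_root, sum_eq_sum_root] at h
    · simp only [hasEdge_attachPaths_root] at h
      rw [adjMatrix_mul_apply, mul_adjMatrix_apply]
      exact h
    · intro x hx
      by_contra h'
      exact hx (hlevel (ite_ne_right_iff.mp h').2).symm
    · intro x hx
      by_contra h'
      exact hx (hlevel (ite_ne_right_iff.mp h').2)

/-- A nonzero `u v w` forces equal colors, hence paths of equal length; thus restricting a row or
column of `u` to the paths reaching a given level drops only zeros. -/
theorem isModel_extendLevels (c₀ : T) {u : Matrix V V B} (hu : G.IsModel u) :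
    (G.attachPaths n c₀).IsModel (extendLevels G n u) := by
  have hcolor : ∀ {v w}, u v w ≠ 0 → n (G.vertexColor v) = n (G.vertexColor w) := fun {v w} h => by
    by_contra h'
    exact h (hu.vertex_color v w fun h'' => h' (congrArg n h''))
  constructor
  · intro x y
    simp only [extendLevels, Matrix.of_apply]
    split_ifs
    · exact hu.star_eq _ _
    · exact star_zero B
  · intro x y
    simp only [extendLevels, Matrix.of_apply]
    split_ifs
    · exact hu.sq_eq _ _
    · exact mul_zero _
  · rintro ⟨v, k⟩
    rw [← hu.row_sum v, ← sum_level_eq_sum (G := G) (n := n) k.val (u v) fun w h => by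
      rw [← hcolor h]; exact k.isLt]
    simp only [extendLevels, Matrix.of_apply, eq_comm (a := k.val)]
  · rintro ⟨v, k⟩
    rw [← hu.col_sum v, ← sum_level_eq_sum (G := G) (n := n) k.val (u · v) fun w h => by
      rw [hcolor h]; exact k.isLt]
    simp only [extendLevels, Matrix.of_apply]
  · exact fun _ _ h => absurd rfl h
  · intro c
    classical
    ext ⟨v, k⟩ ⟨w, l⟩
    rw [adjMatrix_mul_apply, mul_adjMatrix_apply]
    simp only [hasEdge_attachPaths, extendLevels, Matrix.of_apply]
    -- Levels become plain natural numbers, free of the bound that depends on the vertex, so both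
    -- sides can be rewritten as sums over `V`.
    set E : V → ℕ → V → ℕ → Prop := fun v k w l => (G.HasEdge c v w ∧ k = 0 ∧ l = 0) ∨
      (c = c₀ ∧ v = w ∧ (k + 1 = l ∨ l + 1 = k)) with hE
    have hleft := sum_level_eq_sum (G := G) (n := n) l.val
      (fun z => if E v k z l then u z w else 0)
      fun z h => by rw [hcolor (ite_ne_right_iff.mp h).2]; exact l.isLt
    have hright := sum_level_eq_sum (G := G) (n := n) k.val
      (fun z => if E z k w l then u v z else 0)
      fun z h => by rw [← hcolor (ite_ne_right_iff.mp h).2]; exact k.isLt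
    refine Eq.trans (Finset.sum_congr rfl fun z _ => ?_) (hleft.trans (Eq.trans ?_
      (hright.symm.trans (Finset.sum_congr rfl fun z _ => ?_))))
    · by_cases hz : z.2.val = l.val
      · simp only [hE, hz, if_true]
      · simp only [hz, if_false, ite_self]
    · by_cases h0 : k.val = 0 ∧ l.val = 0
      · simpa [hE, h0] using hu.sum_hasEdge c v w
      · simp only [hE, h0, and_false, false_or]
        by_cases h1 : c = c₀ ∧ (k.val + 1 = l.val ∨ l.val + 1 = k.val)
        · simp [h1]
        · have h2 : ∀ a b : V, ¬(c = c₀ ∧ a = b ∧ (k.val + 1 = l.val ∨ l.val + 1 = k.val)) :=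
            fun a b h => h1 ⟨h.1, h.2.2⟩
          simp only [h2, if_false]
    · by_cases hz : z.2.val = k.val
      · simp only [hE, hz, if_true]
      · simp only [hz, Ne.symm hz, if_false, ite_self]

/-- Entries between different levels vanish and each level repeats the root block, so a model is
determined by its roots. -/
theorem extendLevels_restrictRoots (hU : (G.attachPaths n c₀).IsModel U)
    (hlevel : ∀ {x y}, U x y ≠ 0 → x.2.val = y.2.val) :
    extendLevels G n (restrictRoots U) = U := by
  ext ⟨v, k, hk⟩ ⟨w, l, hl⟩
  simp only [extendLevels, Matrix.of_apply]
  split_ifs with h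
  · subst h
    exact (hU.level_eq_root hlevel v w k hk hl).symm
  · by_contra h'
    exact h (hlevel (Ne.symm h'))

end AttachPaths

end ColoredGraph

end

/-! ### The isomorphism of compact quantum groups -/

theorem theorem4p5 {V : Type u} {S : Type v} {T : Type w} [Fintype V]
    (G : ColoredGraph V S T) [DecidableRel G.graph.Adj]
    (hdeg : ∀ v : V, 3 ≤ G.graph.degree v)
    (n : S → ℕ) (hn : Set.InjOn n (Set.range G.vertexColor)) (c₀ : T) :
    ∃ φ : G.CQut ≃⋆ₐ[ℂ] (G.attachPaths n c₀).CQut,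
      ∀ x : G.CQut, (G.attachPaths n c₀).comul (φ x) =
        MinTensor.map (φ : G.CQut →⋆ₐ[ℂ] (G.attachPaths n c₀).CQut)
          (φ : G.CQut →⋆ₐ[ℂ] (G.attachPaths n c₀).CQut) (G.comul x) := by
  open ColoredGraph in
  have hU := (G.attachPaths n c₀).isModel_fundRep
  have hlevel : ∀ {x y}, (G.attachPaths n c₀).fundRep x y ≠ 0 → x.2.val = y.2.val :=
    fun h => hU.level_eq hdeg h
  let f := G.liftModel _ (isModel_restrictRoots hU hlevel hn)
  let g := (G.attachPaths n c₀).liftModel _ (isModel_extendLevels c₀ G.isModel_fundRep)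
  have hf : ∀ v w, f (G.fundRep v w) =
      (G.attachPaths n c₀).fundRep (root G n v) (root G n w) :=
    fun v w => G.liftModel_fundRep _ _ v w
  have hg : ∀ x y, g ((G.attachPaths n c₀).fundRep x y) = extendLevels G n G.fundRep x y :=
    fun x y => (G.attachPaths n c₀).liftModel_fundRep _ _ x y
  have hgf : g.comp f = .id ℂ _ := CQut.hom_ext fun v w => by
    rw [StarAlgHom.comp_apply, hf, hg, extendLevels_root]
    rfl
  have hfg : f.comp g = .id ℂ _ := CQut.hom_ext fun x y => by
    rw [StarAlgHom.comp_apply, hg]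
    refine Eq.trans ?_ (congrFun (congrFun (extendLevels_restrictRoots hU hlevel) x) y)
    simp only [extendLevels, Matrix.of_apply]
    split_ifs
    · exact hf _ _
    · exact map_zero f
  refine ⟨StarAlgEquiv.ofStarAlgHom f g hgf hfg, fun x => ?_⟩
  -- On generators, the sum over intermediate vertices shrinks to the roots, because the first
  -- tensor factor, in the row of a root, is zero elsewhere.
  have hcomul : (G.attachPaths n c₀).comul.comp f = (MinTensor.map f f).comp G.comul :=
    CQut.hom_ext fun v w => by
      rw [StarAlgHom.comp_apply, StarAlgHom.comp_apply, hf, comul_fundRep, comul_fundRep, map_sum,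
        sum_eq_sum_root]
      · simp only [MinTensor.map_tmul, hf]
      · intro x hx
        have h : (G.attachPaths n c₀).fundRep (root G n v) x = 0 := by
          by_contra h
          exact hx (hlevel h).symm
        rw [h, MinTensor.tmul, TensorProduct.zero_tmul, map_zero]
  exact DFunLike.congr_fun hcomul x
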